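/- Let $\Bbbk$ be a commutative ring and, for $n\ge 1$, let $\Bbbk S_n$ be the free $\Bbbk$-module with basis $\{F_\sigma\}_{\sigma\in S_n}$; write a permutation as the list of its values, $\sigma=(\sigma_1,\dots,\sigma_n)$. The *non-symmetric associative operad* $\mathcal A$ has spaces $\mathcal A_n=\Bbbk S_n$ ($n\ge 1$), unit $F_{(1)}\in\mathcal A_1$, and partial compositions $\circ_i:\mathcal A_n\otimes\mathcal A_m\to\mathcal A_{n+m-1}$, $1\le i\le n$, given by $F_\sigma\circ_i F_\tau=F_{B_i(\sigma,\tau)}$, where $$B_i(\sigma,\tau)=(a_1,\dots,a_{i-1},b_1,\dots,b_m,a_{i+1},\dots,a_n),$$ with $a_j=\sigma_j$ if $\sigma_j<\sigma_i$, $a_j=\sigma_j+m-1$ if $\sigma_j>\sigma_i$, and $b_k=\tau_k+\sigma_i-1$. Let $H=\bigoplus_{n\ge1}\Bbbk S_n$ be the (non-counital) Malvenuto–Reutenauer coalgebra, with coproduct $$\Delta(F_\sigma)=\sum_{i=1}^{n-1}F_{\mathrm{st}(\sigma_1,\dots,\sigma_i)}\otimes F_{\mathrm{st}(\sigma_{i+1},\dots,\sigma_n)}\qquad(\sigma\in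 S_n),$$ where $\mathrm{st}(a)$ is the permutation with the same relative order as the sequence $a$ of distinct integers. Let $\Delta^{(1)}=\Delta$ and $\Delta^{(k+1)}=(\Delta\otimes\mathrm{id}^{\otimes k})\circ\Delta^{(k)}$, and let $H^{(k)}=\ker\big(\Delta^{(k)}:H\to H^{\otimes(k+1)}\big)$, $k\ge1$, be the coradical filtration of $H$; in particular $H^{(1)}=\ker\Delta$ is the space of primitive elements. For $k\ge0$ and $n\ge1$ put $\mathcal A^{(k)}_n=H^{(k+1)}\cap\Bbbk S_n$. **Theorem.** The sequence $\{\mathcal A^{(k)}\}_{k\ge0}$ is a filtration of the non-symmetric operad $\mathcal A$: one has $\mathcal A^{(k)}_n\subseteq\mathcal A^{(k+1)}_n$ for all $k\ge 0$, $n\ge 1$, and $$\mathcal A^{(k)}_n\circ_i\mathcal A^{(h)}_m\subseteq\mathcal A^{(k+h)}_{n+m-1}\qquad\text{for all } n,m\ge1,\ k,h\ge0,\ 1\le i\le n.$$ In particular, the space of primitive elements $\mathcal A^{(0)}$ is a non-symmetric suboperad of $\mathcal A$: it contains the unit $F_{(1)}$ and is closed under all the partial compositions $\circ_i$. -/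

import Mathlib

open scoped TensorProduct DirectSum

universe u v

/-! ### Non-symmetric operads -/

/-- The arity `n + m - 1` (a positive integer) of a partial composite of operations of arities
`n, m ≥ 1`. -/
abbrev compArity (n m : ℕ+) : ℕ+ := ⟨(n : ℕ) + (m : ℕ) - 1, by have := n.pos; have := m.pos; omega⟩

theorem compArity_right_comm (n m l : ℕ+) :
    compArity (compArity n l) m = compArity (compArity n m) l := by
  apply PNat.eq
  have := n.pos; have := m.pos; have := l.pos
  simp only [compArity, PNat.mk_coe]; omega

theorem compArity_assoc (n m l : ℕ+) :
    compArity n (compArity m l) = compArity (compArity n m) l := by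
  apply PNat.eq
  have := n.pos; have := m.pos; have := l.pos
  simp only [compArity, PNat.mk_coe]; omega

theorem compArity_one (n : ℕ+) : compArity n 1 = n := by
  apply PNat.eq
  simp [compArity]

theorem one_compArity (n : ℕ+) : compArity 1 n = n := by
  apply PNat.eq
  simp [compArity]

/-- A non-symmetric unital operad over `𝕜`: spaces `P n`, `n ≥ 1`, bilinear partial compositions
`∘ᵢ : P n × P m → P (n + m - 1)`, one for each of the `n` input slots, and a unit in `P 1`.
Slots are numbered from `0`, so that the slot `i : Fin n` is the slot `i + 1` of the usual
numbering. `LinearEquiv.cast` only identifies `P a` with `P b` for equal arities `a = b`. -/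
structure NSOperad (𝕜 : Type u) [CommRing 𝕜] where
  space : ℕ+ → Type v
  [addCommGroup : ∀ n, AddCommGroup (space n)]
  [module : ∀ n, Module 𝕜 (space n)]
  comp : ∀ {n m : ℕ+}, Fin n → space n →ₗ[𝕜] space m →ₗ[𝕜] space (compArity n m)
  unit : space 1
  comp_comp_of_lt : ∀ {n m l : ℕ+} (x : space n) (y : space m) (z : space l) (i j : Fin n)
    (_ : i < j),
    comp (n := compArity n m) (m := l)
        ⟨(j : ℕ) + (m : ℕ) - 1, by have := j.2; have := m.pos; simp only [PNat.mk_coe]; omega⟩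
        (comp i x y) z =
      LinearEquiv.cast (R := 𝕜) (M := space) (compArity_right_comm n m l)
        (comp (n := compArity n l) (m := m)
          ⟨(i : ℕ), by have := i.2; have := l.pos; simp only [PNat.mk_coe]; omega⟩
          (comp j x z) y)
  comp_comp_assoc : ∀ {n m l : ℕ+} (x : space n) (y : space m) (z : space l) (i : Fin n)
    (j : Fin m),
    comp (n := compArity n m) (m := l)
        ⟨(i : ℕ) + (j : ℕ), by have := i.2; have := j.2; simp only [PNat.mk_coe]; omega⟩
        (comp i x y) z =
      LinearEquiv.cast (R := 𝕜) (M := space) (compArity_assoc n m l)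
        (comp i x (comp j y z))
  comp_unit : ∀ {n : ℕ+} (x : space n) (i : Fin n),
    LinearEquiv.cast (R := 𝕜) (M := space) (compArity_one n) (comp i x unit) = x
  unit_comp : ∀ {n : ℕ+} (x : space n),
    LinearEquiv.cast (R := 𝕜) (M := space) (one_compArity n) (comp (n := 1) ⟨0, (1 : ℕ+).pos⟩ unit x) = x

attribute [instance] NSOperad.addCommGroup NSOperad.module

namespace NSOperad

variable {𝕜 : Type u} [CommRing 𝕜]

/-- A sequence of subspaces `S n ⊆ P n` is a non-symmetric suboperad if it contains the unit and
is closed under all partial compositions. -/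
structure IsSuboperad (P : NSOperad.{u, v} 𝕜) (S : ∀ n : ℕ+, Submodule 𝕜 (P.space n)) : Prop where
  unit_mem : P.unit ∈ S 1
  comp_mem : ∀ {n m : ℕ+} (i : Fin n) (x : P.space n) (y : P.space m),
    x ∈ S n → y ∈ S m → P.comp i x y ∈ S (compArity n m)

/-- An increasing sequence `S 0 ⊆ S 1 ⊆ ⋯` of sequences of subspaces `S k n ⊆ P n` is a filtration
of the operad `P` if `S k n ∘ᵢ S h m ⊆ S (k + h) (n + m - 1)`. -/
structure IsFiltration (P : NSOperad.{u, v} 𝕜)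
    (S : ℕ → ∀ n : ℕ+, Submodule 𝕜 (P.space n)) : Prop where
  mono : ∀ (k : ℕ) (n : ℕ+), S k n ≤ S (k + 1) n
  comp_mem : ∀ (k h : ℕ) {n m : ℕ+} (i : Fin n) (x : P.space n) (y : P.space m),
    x ∈ S k n → y ∈ S h m → P.comp i x y ∈ S (k + h) (compArity n m)

end NSOperad

/-! ### The non-symmetric associative operad -/

/-- The word of values of `σ`, with positions and values numbered from `0`; junk value `0` beyond
the last letter. -/
def permWord {n : ℕ} (σ : Equiv.Perm (Fin n)) (p : ℕ) : ℕ := if h : p < n then σ ⟨p, h⟩ else 0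

/-- The letter `x` of a word, shifted up by `m - 1` unless it is smaller than the letter `c`. -/
def shiftLetter (m c x : ℕ) : ℕ := if x < c then x else x + m - 1

/-- The word `(a₀, …, aᵢ₋₁, b₀, …, bₘ₋₁, aᵢ₊₁, …)`, where `aⱼ = sⱼ` if `sⱼ < sᵢ` and
`aⱼ = sⱼ + m - 1` if `sⱼ > sᵢ`, and where `bₖ = tₖ + sᵢ`. -/
def insertWord (i m : ℕ) (s t : ℕ → ℕ) (p : ℕ) : ℕ :=
  if p < i then shiftLetter m (s i) (s p)
  else if p < i + m then t (p - i) + s i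
  else shiftLetter m (s i) (s (p + 1 - m))

theorem insertWord_cases (n m i : ℕ) (s t : ℕ → ℕ) (p : ℕ) (hi : i < n) (hp : p < n + m - 1) :
    (∃ a < n, a ≠ i ∧ p = (if a < i then a else a + m - 1) ∧ insertWord i m s t p = shiftLetter m (s i) (s a)) ∨
    (∃ b < m, p = i + b ∧ insertWord i m s t p = t b + s i) := by
  unfold insertWord
  rcases lt_or_ge p i with c | c
  · exact Or.inl ⟨p, by omega, by omega, by rw [if_pos c], by rw [if_pos c]⟩
  rcases lt_or_ge p (i + m) with c' | c'
  · exact Or.inr ⟨p - i, by omega, by omega, by rw [if_neg (by omega), if_pos c']⟩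
  · exact Or.inl ⟨p + 1 - m, by omega, by omega, by rw [if_neg (by omega)]; omega,
      by rw [if_neg (by omega), if_neg (by omega)]⟩

theorem insertWord_injOn (n m i : ℕ) (s t : ℕ → ℕ) (hi : i < n)
   (hs : ∀ a b, a < n → b < n → s a = s b → a = b) (ht : ∀ a b, a < m → b < m → t a = t b → a = b)
   (ht' : ∀ a, a < m → t a < m)
   (p q : ℕ) (hp : p < n + m - 1) (hq : q < n + m - 1) (h : insertWord i m s t p = insertWord i m s t q) : p = q := by
  rcases insertWord_cases n m i s t p hi hp with ⟨a, ha, hai, pa, e⟩ | ⟨a, ha, pa, e⟩ <;>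
    rcases insertWord_cases n m i s t q hi hq with ⟨b, hb, hbi, pb, e'⟩ | ⟨b, hb, pb, e'⟩ <;>
    rw [e, e'] at h
  · have := hs a i ha hi
    have := hs b i hb hi
    have : a = b := hs a b ha hb (by grind [shiftLetter])
    rw [pa, pb, this]
  · have := hs a i ha hi
    have := ht' b hb
    grind [shiftLetter]
  · have := hs b i hb hi
    have := ht' a ha
    grind [shiftLetter]
  · have := ht a b ha hb (by omega)
    omega

theorem insertWord_comm (n m l i j : ℕ) (hm : 0 < m) (hl : 0 < l) (s t r : ℕ → ℕ) (hij : i < j) (hj : j < n)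
   (hs : ∀ a b, a < n → b < n → s a = s b → a = b)
   (ht' : ∀ a, a < m → t a < m) (hr' : ∀ a, a < l → r a < l)
   (p : ℕ) (hp : p < n + m - 1 + l - 1)  :
   insertWord (j + m - 1) l (insertWord i m s t) r p = insertWord i m (insertWord j l s r) t p := by
  have e1 : insertWord i m s t (j + m - 1) = shiftLetter m (s i) (s j) := by
    simp only [insertWord]; rw [if_neg (by omega), if_neg (by omega)]; congr 2; omega
  have e2 : insertWord j l s r i = shiftLetter l (s j) (s i) := by
    simp only [insertWord]; rw [if_pos (by omega)]
  have hne := hs i j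
  rw [insertWord, insertWord.eq_def i m (insertWord j l s r) t p, e1, e2]
  rcases lt_or_ge p i with c | c
  · rw [if_pos (by omega), if_pos c, insertWord, insertWord, if_pos c, if_pos (by omega)]
    have := hs p i
    have := hs p j
    grind [shiftLetter]
  rcases lt_or_ge p (i + m) with c | c
  · rw [if_pos (by omega), if_neg (by omega), if_pos c, insertWord, if_neg (by omega), if_pos c]
    have := ht' (p - i)
    grind [shiftLetter]
  rcases lt_or_ge p (j + m - 1) with c | c
  · rw [if_pos (by omega), if_neg (by omega), if_neg (by omega), insertWord, if_neg (by omega), if_neg (by omega), insertWord, if_pos (by omega)]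
    have := hs (p + 1 - m) i
    have := hs (p + 1 - m) j
    grind [shiftLetter]
  rcases lt_or_ge p (j + m - 1 + l) with c | c
  · rw [if_neg (by omega), if_pos (by omega), if_neg (by omega), if_neg (by omega), insertWord, if_neg (by omega), if_pos (by omega)]
    have := hr' (p - (j + m - 1))
    have e : p - (j + m - 1) = p + 1 - m - j := by omega
    grind [shiftLetter]
  · rw [if_neg (by omega), if_neg (by omega), if_neg (by omega), if_neg (by omega), insertWord, if_neg (by omega), if_neg (by omega), insertWord, if_neg (by omega), if_neg (by omega)]
    have := hs (p + 1 - m + 1 - l) i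
    have := hs (p + 1 - m + 1 - l) j
    have e : p + 1 - l + 1 - m = p + 1 - m + 1 - l := by omega
    rw [e]
    grind [shiftLetter]

theorem insertWord_assoc (n m l i j : ℕ) (hi : i < n) (hj : j < m) (s t r : ℕ → ℕ) 
   (hs : ∀ a b, a < n → b < n → s a = s b → a = b)
   (ht' : ∀ a, a < m → t a < m) (hl : 0 < l)
   (p : ℕ) (hp : p < n + m - 1 + l - 1)  :
   insertWord (i + j) l (insertWord i m s t) r p = insertWord i (m + l - 1) s (insertWord j l t r) p := by
  have e1 : insertWord i m s t (i + j) = t j + s i := by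
    simp only [insertWord]; rw [if_neg (by omega), if_pos (by omega)]; congr 2; omega
  have hj' := ht' j hj
  rw [insertWord, insertWord.eq_def i _ s (insertWord j l t r) p, e1]
  rcases lt_or_ge p i with c | c
  · rw [if_pos (by omega), if_pos c, insertWord, if_pos c]
    have := hs p i
    grind [shiftLetter]
  rcases lt_or_ge p (i + j) with c | c
  · rw [if_pos (by omega), if_neg (by omega), if_pos (by omega), insertWord, if_neg (by omega), if_pos (by omega), insertWord, if_pos (by omega)]
    grind [shiftLetter]
  rcases lt_or_ge p (i + j + l) with c | c
  · rw [if_neg (by omega), if_pos (by omega), if_neg (by omega), if_pos (by omega), insertWord, if_neg (by omega), if_pos (by omega)]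
    have e : p - (i + j) = p - i - j := by omega
    grind
  rcases lt_or_ge p (i + m + l - 1) with c | c
  · rw [if_neg (by omega), if_neg (by omega), if_neg (by omega), if_pos (by omega), insertWord, if_neg (by omega), if_pos (by omega), insertWord, if_neg (by omega), if_neg (by omega)]
    have e : p - i + 1 - l = p + 1 - l - i := by omega
    rw [e]
    grind [shiftLetter]
  · rw [if_neg (by omega), if_neg (by omega), if_neg (by omega), if_neg (by omega), insertWord, if_neg (by omega), if_neg (by omega)]
    have := hs (p + 1 - l + 1 - m) i
    have e : p + 1 - (m + l - 1) = p + 1 - l + 1 - m := by omega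
    rw [e]
    grind [shiftLetter]

theorem one_insertWord (m : ℕ) (t s : ℕ → ℕ) (hs : s 0 = 0) (p : ℕ) (hp : p < m) : insertWord 0 m s t p = t p := by
  simp [insertWord, hp, hs]

theorem insertWord_one (i : ℕ) (s t : ℕ → ℕ) (ht : t 0 = 0) (p : ℕ) : insertWord i 1 s t p = s p := by
  simp only [insertWord, shiftLetter]
  grind

theorem insertWord_congr (n m i : ℕ) (hi : i < n) (s s' t t' : ℕ → ℕ)
    (hs : ∀ p < n, s p = s' p) (ht : ∀ p < m, t p = t' p) (p : ℕ) (hp : p < n + m - 1) :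
    insertWord i m s t p = insertWord i m s' t' p := by
  unfold insertWord
  rw [hs i hi]
  split_ifs with h₁ h₂
  · rw [hs p (by omega)]
  · rw [ht _ (by omega)]
  · rw [hs _ (by omega)]

theorem permWord_of_lt {n : ℕ} (σ : Equiv.Perm (Fin n)) {p : ℕ} (h : p < n) :
    permWord σ p = σ ⟨p, h⟩ := dif_pos h

theorem permWord_lt {n : ℕ} (σ : Equiv.Perm (Fin n)) (p : ℕ) (h : p < n) : permWord σ p < n := by
  rw [permWord_of_lt σ h]; exact (σ _).2

theorem permWord_inj {n : ℕ} (σ : Equiv.Perm (Fin n)) (p q : ℕ) (hp : p < n) (hq : q < n)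
    (h : permWord σ p = permWord σ q) : p = q := by
  rw [permWord_of_lt σ hp, permWord_of_lt σ hq] at h
  simpa using σ.injective (Fin.ext h)

theorem perm_ext_word {n : ℕ} (σ τ : Equiv.Perm (Fin n))
    (h : ∀ p < n, permWord σ p = permWord τ p) : σ = τ := by
  ext p
  have := h p p.2
  rwa [permWord_of_lt σ p.2, permWord_of_lt τ p.2] at this

theorem insertWord_lt {n m : ℕ} (i : Fin n) (σ : Equiv.Perm (Fin n)) (τ : Equiv.Perm (Fin m))
    (p : ℕ) (hp : p < n + m - 1) :
    insertWord i m (permWord σ) (permWord τ) p < n + m - 1 := by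
  have hi := permWord_lt σ i i.2
  rcases insertWord_cases n m i (permWord σ) (permWord τ) p i.2 hp with
    ⟨a, ha, hai, -, e⟩ | ⟨b, hb, -, e⟩ <;> rw [e]
  · have := permWord_lt σ a ha
    have := mt (permWord_inj σ a i ha i.2) hai
    grind [shiftLetter]
  · have := permWord_lt τ b hb
    omega

/-- The permutation `Bᵢ(σ, τ)` obtained by inserting `τ` at the `i`-th letter of `σ`; its matrix
is that of `σ` with the matrix of `τ` inserted at the entry `(σ i, i)`. -/
noncomputable def permInsert {n m : ℕ} (i : Fin n) (σ : Equiv.Perm (Fin n))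
    (τ : Equiv.Perm (Fin m)) : Equiv.Perm (Fin (n + m - 1)) :=
  Equiv.ofBijective
    (fun p => ⟨insertWord i m (permWord σ) (permWord τ) p, insertWord_lt i σ τ p p.2⟩)
    (Finite.injective_iff_bijective.mp fun p q h =>
      Fin.ext (insertWord_injOn n m i (permWord σ) (permWord τ) i.2 (permWord_inj σ)
        (permWord_inj τ) (permWord_lt τ) p q p.2 q.2 (congrArg Fin.val h)))

theorem permWord_permInsert {n m : ℕ} (i : Fin n) (σ : Equiv.Perm (Fin n))
    (τ : Equiv.Perm (Fin m)) (p : ℕ) (hp : p < n + m - 1) :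
    permWord (permInsert i σ τ) p = insertWord i m (permWord σ) (permWord τ) p :=
  permWord_of_lt _ hp

theorem permWord_permInsert_comm {n m l : ℕ} (hm : 0 < m) (hl : 0 < l)
    (σ : Equiv.Perm (Fin n)) (τ : Equiv.Perm (Fin m)) (ρ : Equiv.Perm (Fin l))
    (i j : Fin n) (h : i < j) (I : Fin (n + l - 1)) (hI : (I : ℕ) = i)
    (J : Fin (n + m - 1)) (hJ : (J : ℕ) = j + m - 1) (p : ℕ) (hp : p < n + m - 1 + l - 1) :
    permWord (permInsert J (permInsert i σ τ) ρ) p =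
      permWord (permInsert I (permInsert j σ ρ) τ) p := by
  have hj := j.2
  rw [permWord_permInsert _ _ _ _ hp, permWord_permInsert _ _ _ _ (by omega),
    insertWord_congr (n + m - 1) l _ J.2 _ _ _ _
      (fun p hp => permWord_permInsert i σ τ p hp) (fun _ _ => rfl) p hp,
    insertWord_congr (n + l - 1) m _ I.2 _ _ _ _
      (fun p hp => permWord_permInsert j σ ρ p hp) (fun _ _ => rfl) p (by omega), hI, hJ]
  exact insertWord_comm n m l i j hm hl _ _ _ h hj (permWord_inj σ) (permWord_lt τ)
    (permWord_lt ρ) p hp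

theorem permWord_permInsert_assoc {n m l : ℕ} (hl : 0 < l)
    (σ : Equiv.Perm (Fin n)) (τ : Equiv.Perm (Fin m)) (ρ : Equiv.Perm (Fin l))
    (i : Fin n) (j : Fin m) (J : Fin (n + m - 1)) (hJ : (J : ℕ) = i + j)
    (p : ℕ) (hp : p < n + m - 1 + l - 1) :
    permWord (permInsert J (permInsert i σ τ) ρ) p =
      permWord (permInsert i σ (permInsert j τ ρ)) p := by
  have hi := i.2
  have hj := j.2
  rw [permWord_permInsert _ _ _ _ hp, permWord_permInsert _ _ _ _ (by omega),
    insertWord_congr (n + m - 1) l _ J.2 _ _ _ _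
      (fun p hp => permWord_permInsert i σ τ p hp) (fun _ _ => rfl) p hp,
    insertWord_congr n (m + l - 1) _ i.2 _ _ _ _ (fun _ _ => rfl)
      (fun p hp => permWord_permInsert j τ ρ p hp) p (by omega), hJ]
  exact insertWord_assoc n m l i j hi hj _ _ _ (permWord_inj σ) (permWord_lt τ) hl p hp

theorem permWord_permInsert_one {n : ℕ} (σ : Equiv.Perm (Fin n)) (i : Fin n) (p : ℕ) (hp : p < n) :
    permWord σ p = permWord (permInsert i σ (1 : Equiv.Perm (Fin 1))) p := by
  rw [permWord_permInsert _ _ _ _ (by omega)]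
  exact (insertWord_one i _ _ (by simp [permWord]) p).symm

theorem permWord_one_permInsert {n : ℕ} (σ : Equiv.Perm (Fin n)) (i : Fin 1) (p : ℕ) (hp : p < n) :
    permWord σ p = permWord (permInsert i (1 : Equiv.Perm (Fin 1)) σ) p := by
  rw [permWord_permInsert _ _ _ _ (by omega), Fin.val_eq_zero i]
  exact (one_insertWord n _ _ (by simp [permWord]) p hp).symm

/-- The space `𝕜 Sₙ`, with basis `F_σ = Finsupp.single σ 1` indexed by the permutations `σ`. -/
abbrev PermSpace (𝕜 : Type u) [CommRing 𝕜] (n : ℕ) : Type u := Equiv.Perm (Fin n) →₀ 𝕜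

/-- The bilinear map `∘ᵢ` with `F_σ ∘ᵢ F_τ = F_{Bᵢ(σ, τ)}`. -/
noncomputable def permComp (𝕜 : Type u) [CommRing 𝕜] {n m : ℕ} (i : Fin n) :
    PermSpace 𝕜 n →ₗ[𝕜] PermSpace 𝕜 m →ₗ[𝕜] PermSpace 𝕜 (n + m - 1) :=
  Finsupp.linearCombination 𝕜 fun σ =>
    Finsupp.linearCombination 𝕜 fun τ => Finsupp.single (permInsert i σ τ) (1 : 𝕜)

theorem permComp_single (𝕜 : Type u) [CommRing 𝕜] {n m : ℕ} (i : Fin n) (σ : Equiv.Perm (Fin n))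
    (τ : Equiv.Perm (Fin m)) :
    permComp 𝕜 i (Finsupp.single σ 1) (Finsupp.single τ 1) =
      Finsupp.single (permInsert i σ τ) 1 := by
  simp [permComp]

theorem permComp_permComp_single (𝕜 : Type u) [CommRing 𝕜] {n m l : ℕ} (i : Fin n)
    (j : Fin (n + m - 1)) (σ : Equiv.Perm (Fin n)) (τ : Equiv.Perm (Fin m))
    (ρ : Equiv.Perm (Fin l)) :
    permComp 𝕜 j (permComp 𝕜 i (Finsupp.single σ 1) (Finsupp.single τ 1)) (Finsupp.single ρ 1) =
      Finsupp.single (permInsert j (permInsert i σ τ) ρ) 1 := by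
  rw [permComp_single, permComp_single]

theorem permComp_permComp_single' (𝕜 : Type u) [CommRing 𝕜] {n m l : ℕ} (i : Fin n)
    (j : Fin m) (σ : Equiv.Perm (Fin n)) (τ : Equiv.Perm (Fin m)) (ρ : Equiv.Perm (Fin l)) :
    permComp 𝕜 i (Finsupp.single σ 1) (permComp 𝕜 j (Finsupp.single τ 1) (Finsupp.single ρ 1)) =
      Finsupp.single (permInsert i σ (permInsert j τ ρ)) 1 := by
  rw [permComp_single, permComp_single]

theorem cast_permSpace_single (𝕜 : Type u) [CommRing 𝕜] {a b : ℕ+} (h : a = b)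
    (σ : Equiv.Perm (Fin a)) (τ : Equiv.Perm (Fin b))
    (hw : ∀ p < (b : ℕ), permWord τ p = permWord σ p) :
    LinearEquiv.cast (R := 𝕜) (M := fun n : ℕ+ => PermSpace 𝕜 n) h (Finsupp.single σ 1) =
      Finsupp.single τ 1 := by
  subst h
  rw [perm_ext_word τ σ hw]
  rfl

theorem PermSpace.induction {𝕜 : Type u} [CommRing 𝕜] {n : ℕ} {p : PermSpace 𝕜 n → Prop}
    (zero : p 0) (add : ∀ x y, p x → p y → p (x + y)) (smul : ∀ (c : 𝕜) x, p x → p (c • x))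
    (basis : ∀ σ, p (Finsupp.single σ 1)) (x : PermSpace 𝕜 n) : p x := by
  induction x using Finsupp.induction_linear with
  | zero => exact zero
  | add x y hx hy => exact add x y hx hy
  | single σ c => simpa using smul c _ (basis σ)

theorem PermSpace.trilinear_ext {𝕜 : Type u} [CommRing 𝕜] {n m l : ℕ} {U W V V' : Type u}
    [AddCommGroup U] [Module 𝕜 U] [AddCommGroup W] [Module 𝕜 W]
    [AddCommGroup V] [Module 𝕜 V] [AddCommGroup V'] [Module 𝕜 V']
    (f : PermSpace 𝕜 n →ₗ[𝕜] PermSpace 𝕜 m →ₗ[𝕜] U) (g : U →ₗ[𝕜] PermSpace 𝕜 l →ₗ[𝕜] V)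
    (f' : PermSpace 𝕜 n →ₗ[𝕜] PermSpace 𝕜 l →ₗ[𝕜] W) (g' : W →ₗ[𝕜] PermSpace 𝕜 m →ₗ[𝕜] V')
    (e : V' ≃ₗ[𝕜] V)
    (h : ∀ σ τ ρ, g (f (Finsupp.single σ 1) (Finsupp.single τ 1)) (Finsupp.single ρ 1) =
      e (g' (f' (Finsupp.single σ 1) (Finsupp.single ρ 1)) (Finsupp.single τ 1))) (x y z) :
    g (f x y) z = e (g' (f' x z) y) := by
  induction x using PermSpace.induction with
  | zero => simp
  | add x y hx hy => simp only [map_add, LinearMap.add_apply, hx, hy]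
  | smul c x hx => simp only [map_smul, LinearMap.smul_apply, hx]
  | basis σ =>
  induction y using PermSpace.induction with
  | zero => simp
  | add x y hx hy => simp only [map_add, LinearMap.add_apply, hx, hy]
  | smul c x hx => simp only [map_smul, LinearMap.smul_apply, hx]
  | basis τ =>
  induction z using PermSpace.induction with
  | zero => simp
  | add x y hx hy => simp only [map_add, LinearMap.add_apply, hx, hy]
  | smul c x hx => simp only [map_smul, LinearMap.smul_apply, hx]
  | basis ρ =>
  exact h σ τ ρ

theorem PermSpace.trilinear_ext' {𝕜 : Type u} [CommRing 𝕜] {n m l : ℕ} {U W V V' : Type u}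
    [AddCommGroup U] [Module 𝕜 U] [AddCommGroup W] [Module 𝕜 W]
    [AddCommGroup V] [Module 𝕜 V] [AddCommGroup V'] [Module 𝕜 V']
    (f : PermSpace 𝕜 n →ₗ[𝕜] PermSpace 𝕜 m →ₗ[𝕜] U) (g : U →ₗ[𝕜] PermSpace 𝕜 l →ₗ[𝕜] V)
    (f' : PermSpace 𝕜 m →ₗ[𝕜] PermSpace 𝕜 l →ₗ[𝕜] W) (g' : PermSpace 𝕜 n →ₗ[𝕜] W →ₗ[𝕜] V')
    (e : V' ≃ₗ[𝕜] V)
    (h : ∀ σ τ ρ, g (f (Finsupp.single σ 1) (Finsupp.single τ 1)) (Finsupp.single ρ 1) =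
      e (g' (Finsupp.single σ 1) (f' (Finsupp.single τ 1) (Finsupp.single ρ 1)))) (x y z) :
    g (f x y) z = e (g' x (f' y z)) := by
  induction x using PermSpace.induction with
  | zero => simp
  | add x y hx hy => simp only [map_add, LinearMap.add_apply, hx, hy]
  | smul c x hx => simp only [map_smul, LinearMap.smul_apply, hx]
  | basis σ =>
  induction y using PermSpace.induction with
  | zero => simp
  | add x y hx hy => simp only [map_add, LinearMap.add_apply, hx, hy]
  | smul c x hx => simp only [map_smul, LinearMap.smul_apply, hx]
  | basis τ =>
  induction z using PermSpace.induction with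
  | zero => simp
  | add x y hx hy => simp only [map_add, hx, hy]
  | smul c x hx => simp only [map_smul, hx]
  | basis ρ =>
  exact h σ τ ρ

theorem PermSpace.linear_ext {𝕜 : Type u} [CommRing 𝕜] {n : ℕ} {V : Type u}
    [AddCommGroup V] [Module 𝕜 V] (f : PermSpace 𝕜 n →ₗ[𝕜] V) (e : V ≃ₗ[𝕜] PermSpace 𝕜 n)
    (h : ∀ σ, e (f (Finsupp.single σ 1)) = Finsupp.single σ 1) (x) : e (f x) = x := by
  induction x using PermSpace.induction with
  | zero => simp
  | add x y hx hy => simp only [map_add, hx, hy]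
  | smul c x hx => simp only [map_smul, hx]
  | basis σ =>
  exact h σ

/-- The non-symmetric associative operad `𝒜`: the spaces `𝕜 Sₙ`, `n ≥ 1`, with
`F_σ ∘ᵢ F_τ = F_{Bᵢ(σ, τ)}` and unit `F_{(1)}`. -/
noncomputable abbrev nsAssoc (𝕜 : Type u) [CommRing 𝕜] : NSOperad.{u, u} 𝕜 where
  space n := PermSpace 𝕜 n
  comp i := permComp 𝕜 i
  unit := Finsupp.single 1 1
  comp_comp_of_lt {n m l} x y z i j h :=
    PermSpace.trilinear_ext (permComp 𝕜 i) (permComp 𝕜 _) (permComp 𝕜 j) (permComp 𝕜 _)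
      (LinearEquiv.cast (R := 𝕜) (M := fun n : ℕ+ => PermSpace 𝕜 n) (compArity_right_comm n m l))
      (fun σ τ ρ => (permComp_permComp_single 𝕜 i _ σ τ ρ).trans <|
        (cast_permSpace_single 𝕜 (compArity_right_comm n m l) _ _
          (permWord_permInsert_comm m.pos l.pos σ τ ρ i j h _ rfl _ rfl)).symm.trans
          (congrArg _ (permComp_permComp_single 𝕜 j _ σ ρ τ).symm)) x y z
  comp_comp_assoc {n m l} x y z i j :=
    PermSpace.trilinear_ext' (permComp 𝕜 i) (permComp 𝕜 _) (permComp 𝕜 j) (permComp 𝕜 i)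
      (LinearEquiv.cast (R := 𝕜) (M := fun n : ℕ+ => PermSpace 𝕜 n) (compArity_assoc n m l))
      (fun σ τ ρ => (permComp_permComp_single 𝕜 i _ σ τ ρ).trans <|
        (cast_permSpace_single 𝕜 (compArity_assoc n m l) _ _
          (permWord_permInsert_assoc l.pos σ τ ρ i j _ rfl)).symm.trans
          (congrArg _ (permComp_permComp_single' 𝕜 i j σ τ ρ).symm)) x y z
  comp_unit {n} x i :=
    PermSpace.linear_ext ((permComp 𝕜 i).flip (Finsupp.single 1 1))
      (LinearEquiv.cast (R := 𝕜) (M := fun n : ℕ+ => PermSpace 𝕜 n) (compArity_one n))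
      (fun σ => (congrArg _ (permComp_single 𝕜 i σ (1 : Equiv.Perm (Fin 1)))).trans
        (cast_permSpace_single 𝕜 (compArity_one n) _ _ (permWord_permInsert_one σ i))) x
  unit_comp {n} x :=
    PermSpace.linear_ext (permComp 𝕜 _ (Finsupp.single 1 1))
      (LinearEquiv.cast (R := 𝕜) (M := fun n : ℕ+ => PermSpace 𝕜 n) (one_compArity n))
      (fun σ => (congrArg _ (permComp_single 𝕜 _ (1 : Equiv.Perm (Fin 1)) σ)).trans
        (cast_permSpace_single 𝕜 (one_compArity n) _ _ (permWord_one_permInsert σ _))) x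

/-! ### The Malvenuto–Reutenauer coalgebra -/

/-- The standardization of a word `f` with distinct letters: the permutation with the same
relative order of its letters as `f` (see `standardize_lt_iff`). -/
def standardize {n : ℕ} (f : Fin n → ℕ) : Equiv.Perm (Fin n) := (Tuple.sort f).symm

theorem standardize_lt_iff {n : ℕ} (f : Fin n → ℕ) (hf : Function.Injective f) (a b : Fin n) :
    standardize f a < standardize f b ↔ f a < f b := by
  have h : StrictMono (f ∘ Tuple.sort f) :=
    (Tuple.monotone_sort f).strictMono_of_injective (hf.comp (Tuple.sort f).injective)
  have := h.lt_iff_lt (a := standardize f a) (b := standardize f b)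
  simpa [standardize] using this.symm

/-- The standardization of the first `i` letters of `σ`. -/
def initialPerm {n : ℕ} (σ : Equiv.Perm (Fin n)) (i : ℕ) (hi : i ≤ n) : Equiv.Perm (Fin i) :=
  standardize fun p => (σ ⟨p, by omega⟩ : ℕ)

/-- The standardization of the last `n - i` letters of `σ`. -/
def finalPerm {n : ℕ} (σ : Equiv.Perm (Fin n)) (i : ℕ) : Equiv.Perm (Fin (n - i)) :=
  standardize fun p => (σ ⟨i + p, by omega⟩ : ℕ)

/-- The space `H = ⨁_{n ≥ 1} 𝕜 Sₙ`. -/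
abbrev MRSpace (𝕜 : Type u) [CommRing 𝕜] : Type u := ⨁ n : ℕ+, PermSpace 𝕜 n

/-- The inclusion of the component `𝕜 Sₙ` of degree `n` in `H`. -/
noncomputable abbrev MRSpace.incl (𝕜 : Type u) [CommRing 𝕜] (n : ℕ+) :
    PermSpace 𝕜 n →ₗ[𝕜] MRSpace 𝕜 :=
  DirectSum.lof 𝕜 ℕ+ (fun n : ℕ+ => PermSpace 𝕜 n) n

/-- The basis element `F_σ` of `H`, for `σ` a permutation of `n ≥ 1` letters. -/
noncomputable def MRSpace.F (𝕜 : Type u) [CommRing 𝕜] (n : ℕ) (hn : 0 < n)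
    (σ : Equiv.Perm (Fin n)) : MRSpace 𝕜 :=
  MRSpace.incl 𝕜 ⟨n, hn⟩ (Finsupp.single σ 1)

/-- The coproduct `Δ(F_σ) = ∑_{0 < i < n} F_{st(σ₁, …, σᵢ)} ⊗ F_{st(σᵢ₊₁, …, σₙ)}` of the
(non-counital) Malvenuto–Reutenauer coalgebra. -/
noncomputable def MRSpace.coproduct (𝕜 : Type u) [CommRing 𝕜] :
    MRSpace 𝕜 →ₗ[𝕜] MRSpace 𝕜 ⊗[𝕜] MRSpace 𝕜 :=
  DirectSum.toModule 𝕜 ℕ+ _ fun n => Finsupp.linearCombination 𝕜 fun σ =>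
    ∑ i : Finset.Ioo 0 (n : ℕ),
      MRSpace.F 𝕜 i (Finset.mem_Ioo.mp i.2).1
          (initialPerm σ i (Finset.mem_Ioo.mp i.2).2.le) ⊗ₜ[𝕜]
        MRSpace.F 𝕜 ((n : ℕ) - i) (Nat.sub_pos_of_lt (Finset.mem_Ioo.mp i.2).2) (finalPerm σ i)

/-- The canonical isomorphism `V ⊗ V^{⊗ k} ≃ V^{⊗ (k + 1)}` (see `tensorHead_tmul`). -/
noncomputable def tensorHead (𝕜 : Type u) [CommRing 𝕜] (V : Type v) [AddCommGroup V] [Module 𝕜 V]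
    (k : ℕ) : V ⊗[𝕜] (⨂[𝕜]^k V) ≃ₗ[𝕜] (⨂[𝕜]^(k + 1) V) :=
  (TensorProduct.congr (PiTensorProduct.subsingletonEquiv (R := 𝕜) (s := fun _ => V) (0 : Fin 1)).symm
      (LinearEquiv.refl 𝕜 (⨂[𝕜]^k V))).trans
    (TensorPower.mulEquiv.trans (TensorPower.cast 𝕜 V (Nat.add_comm 1 k)))

theorem tensorHead_tmul (𝕜 : Type u) [CommRing 𝕜] (V : Type v) [AddCommGroup V] [Module 𝕜 V]
    (k : ℕ) (x : V) (f : Fin k → V) :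
    tensorHead 𝕜 V k (x ⊗ₜ[𝕜] PiTensorProduct.tprod 𝕜 f) =
      PiTensorProduct.tprod 𝕜 (Fin.cons x f : Fin (k + 1) → V) := by
  have h : (PiTensorProduct.subsingletonEquiv (R := 𝕜) (s := fun _ => V) (0 : Fin 1)).symm x =
      PiTensorProduct.tprod 𝕜 fun _ : Fin 1 => x := by
    rw [LinearEquiv.symm_apply_eq]; simp
  simp only [tensorHead, LinearEquiv.trans_apply, TensorProduct.congr_tmul,
    LinearEquiv.refl_apply, h]
  erw [← TensorPower.gMul_def, TensorPower.tprod_mul_tprod, TensorPower.cast_tprod]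
  congr 1
  funext a
  refine Fin.cases ?_ (fun b => ?_) a
  · simp [Fin.append, Fin.addCases]
  · simp [Fin.append, Fin.addCases, Fin.subNat]

/-- The iterated coproducts `Δ^{(k)} : H → H^{⊗ (k + 1)}`, with `Δ^{(0)} = id` and
`Δ^{(k + 1)} = (Δ ⊗ id^{⊗ k}) ∘ Δ^{(k)}`, so that `Δ^{(1)} = Δ`. -/
noncomputable def MRSpace.iterCoproduct (𝕜 : Type u) [CommRing 𝕜] :
    (k : ℕ) → MRSpace 𝕜 →ₗ[𝕜] (⨂[𝕜]^(k + 1) (MRSpace 𝕜))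
  | 0 => (PiTensorProduct.subsingletonEquiv (R := 𝕜) (s := fun _ => MRSpace 𝕜) (0 : Fin 1)).symm.toLinearMap
  | k + 1 =>
    (tensorHead 𝕜 (MRSpace 𝕜) (k + 1)).toLinearMap ∘ₗ
      (tensorHead 𝕜 (MRSpace 𝕜) k).toLinearMap.lTensor (MRSpace 𝕜) ∘ₗ
      (TensorProduct.assoc 𝕜 (MRSpace 𝕜) (MRSpace 𝕜) (⨂[𝕜]^k (MRSpace 𝕜))).toLinearMap ∘ₗ
      (MRSpace.coproduct 𝕜).rTensor (⨂[𝕜]^k (MRSpace 𝕜)) ∘ₗ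
      (tensorHead 𝕜 (MRSpace 𝕜) k).symm.toLinearMap ∘ₗ
      MRSpace.iterCoproduct 𝕜 k

/-- The space of primitive elements of `H`. -/
noncomputable def MRSpace.primitives (𝕜 : Type u) [CommRing 𝕜] : Submodule 𝕜 (MRSpace 𝕜) :=
  LinearMap.ker (MRSpace.coproduct 𝕜)

/-- The component `H^{(k)} = ker Δ^{(k)}`, `k ≥ 1`, of the coradical filtration of `H`. -/
noncomputable def MRSpace.coradical (𝕜 : Type u) [CommRing 𝕜] (k : ℕ) : Submodule 𝕜 (MRSpace 𝕜) :=
  LinearMap.ker (MRSpace.iterCoproduct 𝕜 k)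

/-- The homogeneous component `𝒜^{(k)}_n = H^{(k + 1)} ∩ 𝕜 Sₙ`, `k ≥ 0`, `n ≥ 1`. -/
noncomputable def coradicalPart (𝕜 : Type u) [CommRing 𝕜] (k : ℕ) (n : ℕ+) :
    Submodule 𝕜 (PermSpace 𝕜 n) :=
  (MRSpace.coradical 𝕜 (k + 1)).comap (MRSpace.incl 𝕜 n)

/-- The space of primitive elements of degree `n ≥ 1`. -/
noncomputable def primitivePart (𝕜 : Type u) [CommRing 𝕜] (n : ℕ+) :
    Submodule 𝕜 (PermSpace 𝕜 n) :=
  (MRSpace.primitives 𝕜).comap (MRSpace.incl 𝕜 n)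

/-!
The iterated coproduct `Δ^{(k)}(F_σ)` is the sum, over all choices of `k` cuts of the word `σ`, of
the tensor products of the standardizations of the `k + 1` resulting blocks
(`MRSpace.iterCoproduct_basisElt_segIndex`). Tensor products of the basis elements `F_τ` are
linearly independent, and the lengths of the blocks determine the cuts. Therefore
`x = ∑ x_σ F_σ` is in the kernel of `Δ^{(k)}` if and only if, for every set `C` of `k` cuts, the
coefficients `x_σ` sum to `0` over each class of permutations with the same standardized blocks
(`MRSpace.sum_smul_cutSum_eq_zero_iff`, `mem_coradicalPart_iff`). Call `x` *null* for `C` in this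
case (`BlockNull`). More cuts make the blocks smaller and the classes larger, so nullity passes to
larger sets of cuts, and the spaces `𝒜^{(k)}` increase with `k`.

Now let `E` be a set of `k + h + 1` cuts of words of `n + m - 1` letters. The `n + m - 2` possible
places for a cut of `Bᵢ(σ, τ)` are the `m - 1` places inside the inserted block, which correspond to
the places in `τ`, and the `n - 1` others, which correspond to the places in `σ`. So `E` has at
least `h + 1` cuts inside or at least `k + 1` cuts outside the inserted block. The letters of the
inserted block compare with any other letter as the letter `σᵢ` of `σ` does; hence the standardized
blocks of `Bᵢ(σ, τ)` depend on `τ` only through the standardized blocks cut out by the inner cuts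
(`SameBlockOrder.insertWord_right`), and on `σ` only through those cut out by the outer cuts
(`SameBlockOrder.insertWord_left`). If `x ∈ 𝒜^{(k)}` and `y ∈ 𝒜^{(h)}`, then `y` is null for the
inner cuts or `x` is null for the outer cuts, and in both cases `x ∘ᵢ y` is null for `E`.
-/

/-! ### Standardization of segments of a word -/

/-- The words `w` and `w'` order their letters at positions in `[a, n)` in the same way, as far as
letters in the same block of the positions cut at the places in `C` are concerned. A cut `d ∈ C`
separates the positions `p < d` from the positions `p ≥ d`. -/
def SameBlockOrder (n a : ℕ) (C : Finset ℕ) (w w' : ℕ → ℕ) : Prop :=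
  ∀ p q, a ≤ p → p < n → a ≤ q → q < n → (∀ d ∈ C, d ≤ p ↔ d ≤ q) →
    (w p < w q ↔ w' p < w' q)

namespace SameBlockOrder

variable {n a : ℕ} {C D : Finset ℕ} {w w' w'' : ℕ → ℕ}

theorem refl (n a : ℕ) (C : Finset ℕ) (w : ℕ → ℕ) : SameBlockOrder n a C w w :=
  fun _ _ _ _ _ _ _ => Iff.rfl

theorem symm (h : SameBlockOrder n a C w w') : SameBlockOrder n a C w' w :=
  fun p q h₁ h₂ h₃ h₄ h₅ => (h p q h₁ h₂ h₃ h₄ h₅).symm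

theorem trans (h : SameBlockOrder n a C w w') (h' : SameBlockOrder n a C w' w'') :
    SameBlockOrder n a C w w'' :=
  fun p q h₁ h₂ h₃ h₄ h₅ => (h p q h₁ h₂ h₃ h₄ h₅).trans (h' p q h₁ h₂ h₃ h₄ h₅)

theorem mono (h : SameBlockOrder n a C w w') (hCD : C ⊆ D) : SameBlockOrder n a D w w' :=
  fun p q h₁ h₂ h₃ h₄ h₅ => h p q h₁ h₂ h₃ h₄ fun d hd => h₅ d (hCD hd)

/-- A cut at the end of the word does not separate anything. -/
theorem insert_end_iff : SameBlockOrder n a (insert n C) w w' ↔ SameBlockOrder n a C w w' := by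
  refine ⟨fun h p q h₁ h₂ h₃ h₄ h₅ => h p q h₁ h₂ h₃ h₄ ?_,
    fun h => h.mono (Finset.subset_insert _ _)⟩
  intro d hd
  rcases Finset.mem_insert.mp hd with rfl | hd
  · omega
  · exact h₅ d hd

/-- The smallest cut `b` splits off the block `[a, b)`. -/
theorem insert_iff {b : ℕ} (hab : a ≤ b) (hbn : b ≤ n) (hC : ∀ d ∈ C, b < d) :
    SameBlockOrder n a (insert b C) w w' ↔
      (∀ p q, a ≤ p → p < b → a ≤ q → q < b → (w p < w q ↔ w' p < w' q)) ∧
        SameBlockOrder n b C w w' := by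
  constructor
  · intro h
    refine ⟨fun p q h₁ h₂ h₃ h₄ => h p q h₁ (by omega) h₃ (by omega) ?_,
      fun p q h₁ h₂ h₃ h₄ h₅ => h p q (by omega) h₂ (by omega) h₄ ?_⟩
    · intro d hd
      rcases Finset.mem_insert.mp hd with rfl | hd
      · omega
      · have := hC d hd
        omega
    · intro d hd
      rcases Finset.mem_insert.mp hd with rfl | hd
      · omega
      · exact h₅ d hd
  · rintro ⟨h, h'⟩ p q h₁ h₂ h₃ h₄ h₅
    have hb := h₅ b (Finset.mem_insert_self _ _)
    rcases lt_or_ge p b with c | c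
    · exact h p q h₁ c h₃ (by omega)
    · exact h' p q c h₂ (by omega) h₄ fun d hd => h₅ d (Finset.mem_insert_of_mem hd)

end SameBlockOrder

theorem perm_eq_of_lt_iff {n : ℕ} (σ τ : Equiv.Perm (Fin n))
    (h : ∀ a b, σ a < σ b ↔ τ a < τ b) : σ = τ := by
  have hm : StrictMono (τ ∘ σ.symm) := fun a b hab => by
    simpa [← h] using hab
  have := hm.range_inj strictMono_id |>.mp <| by
    rw [Set.range_id, (τ.surjective.comp σ.symm.surjective).range_eq]
  ext a
  simpa using (congrArg Fin.val (congrFun this (σ a))).symm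

theorem standardize_eq_iff {n : ℕ} (f : Fin n → ℕ) (hf : Function.Injective f)
    (σ : Equiv.Perm (Fin n)) :
    standardize f = σ ↔ ∀ a b, f a < f b ↔ σ a < σ b := by
  refine ⟨?_, fun h => perm_eq_of_lt_iff _ _ fun a b => ?_⟩
  · rintro rfl a b
    exact (standardize_lt_iff f hf a b).symm
  · rw [standardize_lt_iff f hf, h]

/-! ### The basis of the Malvenuto–Reutenauer coalgebra -/

/-- The index set of the basis of `H`: the permutations of `n ≥ 1` letters, for all `n`. -/
abbrev MRIndex : Type := Σ n : ℕ+, Equiv.Perm (Fin n)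

/-- The index given by a permutation of `n` letters, for a natural number `n` known to be
positive. -/
def MRIndex.ofPerm {n : ℕ} (hn : 0 < n) (σ : Equiv.Perm (Fin n)) : MRIndex :=
  ⟨(⟨n, hn⟩ : ℕ+), σ⟩

theorem MRIndex.ofPerm_inj {n : ℕ} {hn : 0 < n} {σ τ : Equiv.Perm (Fin n)} :
    MRIndex.ofPerm hn σ = MRIndex.ofPerm hn τ ↔ σ = τ :=
  ⟨fun h => eq_of_heq (Sigma.mk.inj h).2, fun h => h ▸ rfl⟩

theorem MRIndex.eq_of_ofPerm_eq {n m : ℕ} {hn : 0 < n} {hm : 0 < m} {σ : Equiv.Perm (Fin n)}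
    {τ : Equiv.Perm (Fin m)} (h : MRIndex.ofPerm hn σ = MRIndex.ofPerm hm τ) : n = m :=
  congrArg (fun s : MRIndex => (s.1 : ℕ)) h

/-- The index of the basis element `F_{st(w_a, …, w_{b-1})}`; the junk value for `b ≤ a` is the
permutation of one letter. -/
noncomputable def segIndex (w : ℕ → ℕ) (a b : ℕ) : MRIndex :=
  if h : a < b then
    MRIndex.ofPerm (Nat.sub_pos_of_lt h) (standardize fun p : Fin (b - a) => w (a + p))
  else MRIndex.ofPerm one_pos 1

theorem segIndex_eq_ofPerm_iff {w : ℕ → ℕ} {a b n : ℕ} (hab : a < b) (hw : Set.InjOn w (Set.Ico a b))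
    (hn : 0 < n) (σ : Equiv.Perm (Fin n)) :
    segIndex w a b = MRIndex.ofPerm hn σ ↔
      a + n = b ∧ ∀ p q : Fin n, w (a + p) < w (a + q) ↔ σ p < σ q := by
  rw [segIndex, dif_pos hab]
  by_cases h : a + n = b
  · obtain rfl : n = b - a := by omega
    have hf : Function.Injective fun p : Fin (b - a) => w (a + p) := fun p q hpq =>
      Fin.ext (by simpa using hw ⟨by omega, by omega⟩ ⟨by omega, by omega⟩ hpq)
    simp only [true_and, h, MRIndex.ofPerm_inj]
    exact standardize_eq_iff _ hf σ
  · refine iff_of_false (fun h' => h ?_) (fun h' => h h'.1)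
    have := MRIndex.eq_of_ofPerm_eq h'
    omega

theorem segIndex_eq_segIndex_iff {w w' : ℕ → ℕ} {a b b' : ℕ} (hab : a < b) (hab' : a < b')
    (hw : Set.InjOn w (Set.Ico a b)) (hw' : Set.InjOn w' (Set.Ico a b')) :
    segIndex w a b = segIndex w' a b' ↔
      b = b' ∧ ∀ p q, a ≤ p → p < b → a ≤ q → q < b → (w p < w q ↔ w' p < w' q) := by
  rw [segIndex.eq_def w', dif_pos hab', segIndex_eq_ofPerm_iff hab hw]
  have hf : Function.Injective fun p : Fin (b' - a) => w' (a + p) := fun p q hpq =>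
    Fin.ext (by simpa using hw' ⟨by omega, by omega⟩ ⟨by omega, by omega⟩ hpq)
  simp only [standardize_lt_iff _ hf]
  constructor
  · rintro ⟨h, h'⟩
    refine ⟨by omega, fun p q h₁ h₂ h₃ h₄ => ?_⟩
    have := h' ⟨p - a, by omega⟩ ⟨q - a, by omega⟩
    simpa [Nat.add_sub_cancel' h₁, Nat.add_sub_cancel' h₃] using this
  · rintro ⟨rfl, h⟩
    exact ⟨by omega, fun p q => h _ _ (by omega) (by omega) (by omega) (by omega)⟩

namespace MRSpace

variable (𝕜 : Type u) [CommRing 𝕜]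

/-- The basis element `F_σ` of `H`. -/
noncomputable def basisElt (s : MRIndex) : MRSpace 𝕜 := incl 𝕜 s.1 (Finsupp.single s.2 1)

/-- The linear form on `H` giving the coefficient of `F_σ`. -/
noncomputable def coeff (s : MRIndex) : MRSpace 𝕜 →ₗ[𝕜] 𝕜 :=
  Finsupp.lapply s.2 ∘ₗ DirectSum.component 𝕜 ℕ+ (fun n : ℕ+ => PermSpace 𝕜 n) s.1

theorem coeff_basisElt (s t : MRIndex) :
    coeff 𝕜 s (basisElt 𝕜 t) = if t = s then 1 else 0 := by
  obtain ⟨n, σ⟩ := s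
  obtain ⟨m, τ⟩ := t
  by_cases h : m = n
  · subst h
    simp [coeff, basisElt, incl, DirectSum.component.lof_self, Finsupp.single_apply]
  · simp [coeff, basisElt, incl, DirectSum.component.of, h]

/-- As `H` is free on the `F_σ`, a tensor in `H ⊗ M` vanishes as soon as its component along each
`F_σ` does. -/
theorem sum_basisElt_tmul_eq_zero_iff {ι : Type*} {M : Type*} [AddCommMonoid M] [Module 𝕜 M]
    (S : Finset ι) (β : ι → MRIndex) (m : ι → M) :
    ∑ j ∈ S, basisElt 𝕜 (β j) ⊗ₜ[𝕜] m j = 0 ↔ ∀ s, ∑ j ∈ S with β j = s, m j = 0 := by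
  constructor
  · intro h s
    have := congrArg ((TensorProduct.lid 𝕜 M).toLinearMap ∘ₗ (coeff 𝕜 s).rTensor M) h
    simpa [coeff_basisElt, ite_smul, Finset.sum_filter] using this
  · intro h
    classical
    rw [← Finset.sum_fiberwise_of_maps_to (t := S.image β)
      (fun j hj => Finset.mem_image_of_mem β hj)]
    refine Finset.sum_eq_zero fun s _ => ?_
    have : ∀ j ∈ S.filter (β · = s), basisElt 𝕜 (β j) ⊗ₜ[𝕜] m j = basisElt 𝕜 s ⊗ₜ m j := by
      intro j hj
      rw [(Finset.mem_filter.mp hj).2]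
    rw [Finset.sum_congr rfl this, ← TensorProduct.tmul_sum, h s, TensorProduct.tmul_zero]

theorem F_eq_basisElt_segIndex {w : ℕ → ℕ} {a b n : ℕ} (hn : 0 < n) (σ : Equiv.Perm (Fin n))
    (hb : a + n = b) (hw : Set.InjOn w (Set.Ico a b))
    (h : ∀ p q : Fin n, w (a + p) < w (a + q) ↔ σ p < σ q) :
    F 𝕜 n hn σ = basisElt 𝕜 (segIndex w a b) := by
  rw [(segIndex_eq_ofPerm_iff (by omega) hw hn σ).mpr ⟨hb, h⟩]
  rfl

/-! ### The iterated coproducts of a basis element -/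

theorem coproduct_F {n : ℕ} (hn : 0 < n) (σ : Equiv.Perm (Fin n)) :
    coproduct 𝕜 (F 𝕜 n hn σ) = ∑ i : Finset.Ioo 0 n,
      F 𝕜 i (Finset.mem_Ioo.mp i.2).1 (initialPerm σ i (Finset.mem_Ioo.mp i.2).2.le) ⊗ₜ[𝕜]
        F 𝕜 (n - i) (Nat.sub_pos_of_lt (Finset.mem_Ioo.mp i.2).2) (finalPerm σ i) := by
  exact (DirectSum.toModule_lof 𝕜 _ _).trans
    ((Finsupp.linearCombination_single 𝕜 _ _).trans (one_smul 𝕜 _))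

/-- Cutting a segment of a word in two, at all places strictly inside it. -/
theorem coproduct_basisElt_segIndex {w : ℕ → ℕ} {a b : ℕ} (hab : a < b)
    (hw : Set.InjOn w (Set.Ico a b)) :
    coproduct 𝕜 (basisElt 𝕜 (segIndex w a b)) =
      ∑ c ∈ Finset.Ioo a b,
        basisElt 𝕜 (segIndex w a c) ⊗ₜ[𝕜] basisElt 𝕜 (segIndex w c b) := by
  have hf : Function.Injective fun p : Fin (b - a) => w (a + p) := fun p q hpq =>
    Fin.ext (by simpa using hw ⟨by omega, by omega⟩ ⟨by omega, by omega⟩ hpq)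
  have key := standardize_lt_iff _ hf
  rw [segIndex, dif_pos hab]
  generalize standardize (fun p : Fin (b - a) => w (a + p)) = σ at key ⊢
  have e : Finset.Ioo a b = (Finset.Ioo 0 (b - a)).map (addLeftEmbedding a) := by
    rw [Finset.map_add_left_Ioo]; congr 1; omega
  rw [e, Finset.sum_map, ← Finset.sum_coe_sort]
  refine (coproduct_F 𝕜 (Nat.sub_pos_of_lt hab) σ).trans ?_
  refine Finset.sum_congr rfl fun ⟨i, hi⟩ _ => ?_
  obtain ⟨hi₀, hi₁⟩ := Finset.mem_Ioo.mp hi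
  have inj : ∀ {l} (g : Fin l → Fin (b - a)), Function.Injective g →
      Function.Injective fun p => (σ (g p) : ℕ) :=
    fun g hg => Fin.val_injective.comp (σ.injective.comp hg)
  simp only [addLeftEmbedding_apply]
  congr 1
  · refine F_eq_basisElt_segIndex 𝕜 _ _ rfl (hw.mono (Set.Ico_subset_Ico_right (by omega))) ?_
    intro p q
    rw [initialPerm, standardize_lt_iff _ (inj _ fun p q h => by simpa [Fin.ext_iff] using h)]
    exact (key ⟨p, by omega⟩ ⟨q, by omega⟩).symm
  · refine F_eq_basisElt_segIndex 𝕜 _ _ (by omega)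
      (hw.mono (Set.Ico_subset_Ico_left (by omega))) ?_
    intro p q
    rw [finalPerm, standardize_lt_iff _ (inj _ fun p q h => by simpa [Fin.ext_iff] using h)]
    simpa only [add_assoc, Fin.lt_def] using (key ⟨i + p, by omega⟩ ⟨i + q, by omega⟩).symm

/-- The sum, over all ways of cutting the segment `(w_a, …, w_{n-1})` into `k` nonempty segments,
of the tensor products of their standardizations. -/
noncomputable def cutSum (n : ℕ) (w : ℕ → ℕ) : (k : ℕ) → ℕ → ⨂[𝕜]^k (MRSpace 𝕜)
  | 0, a => if a = n then PiTensorProduct.tprod 𝕜 Fin.elim0 else 0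
  | k + 1, a => ∑ b ∈ Finset.Ioc a n,
      tensorHead 𝕜 (MRSpace 𝕜) k (basisElt 𝕜 (segIndex w a b) ⊗ₜ[𝕜] cutSum n w k b)

theorem subsingletonEquiv_symm_eq_tensorHead (x : MRSpace 𝕜) :
    (PiTensorProduct.subsingletonEquiv (R := 𝕜) (s := fun _ => MRSpace 𝕜) (0 : Fin 1)).symm x =
      tensorHead 𝕜 (MRSpace 𝕜) 0 (x ⊗ₜ[𝕜] PiTensorProduct.tprod 𝕜 Fin.elim0) := by
  rw [tensorHead_tmul, LinearEquiv.symm_apply_eq]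
  simp

theorem iterCoproduct_basisElt_segIndex {n : ℕ} (hn : 0 < n) {w : ℕ → ℕ}
    (hw : Set.InjOn w (Set.Ico 0 n)) (k : ℕ) :
    iterCoproduct 𝕜 k (basisElt 𝕜 (segIndex w 0 n)) = cutSum 𝕜 n w (k + 1) 0 := by
  induction k with
  | zero =>
    rw [iterCoproduct, LinearEquiv.coe_coe, subsingletonEquiv_symm_eq_tensorHead, cutSum,
      Finset.sum_eq_single n]
    · simp [cutSum]
    · intro b _ hb
      simp [cutSum, hb]
    · simp [hn]
  | succ k ih =>
    simp only [iterCoproduct, LinearMap.comp_apply, ih, LinearEquiv.coe_coe]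
    rw [cutSum]
    simp only [map_sum, LinearEquiv.symm_apply_apply, LinearMap.rTensor_tmul]
    rw [cutSum]
    simp only [cutSum, TensorProduct.tmul_sum, map_sum]
    rw [Finset.sum_comm' (t' := Finset.Ioc 0 n) (s' := fun c => Finset.Ioo 0 c)]
    swap
    · intro b c
      simp only [Finset.mem_Ioc, Finset.mem_Ioo]
      omega
    refine Finset.sum_congr rfl fun c hc => ?_
    obtain ⟨hc₀, hc₁⟩ := Finset.mem_Ioc.mp hc
    rw [coproduct_basisElt_segIndex 𝕜 hc₀ (hw.mono (Set.Ico_subset_Ico_right hc₁))]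
    simp [TensorProduct.sum_tmul]

end MRSpace

/-! ### The kernels of the iterated coproducts -/

theorem permWord_injOn {n : ℕ} (σ : Equiv.Perm (Fin n)) (a b : ℕ) (hb : b ≤ n) :
    Set.InjOn (permWord σ) (Set.Ico a b) :=
  fun p hp q hq h => permWord_inj σ p q (hp.2.trans_le hb) (hq.2.trans_le hb) h

namespace MRSpace

variable (𝕜 : Type u) [CommRing 𝕜]

theorem smul_tprod_elim0_eq_zero_iff (c : 𝕜) :
    c • PiTensorProduct.tprod 𝕜 (Fin.elim0 : Fin 0 → MRSpace 𝕜) = 0 ↔ c = 0 := by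
  rw [← (PiTensorProduct.isEmptyEquiv (R := 𝕜) (s := fun _ => MRSpace 𝕜) (Fin 0)).map_eq_zero_iff]
  simp

open Classical in
/-- Separating the degrees and the basis elements of the first tensor factor. -/
theorem sum_smul_cutSum_succ_eq_zero_iff {n : ℕ} (x : Equiv.Perm (Fin n) → 𝕜) (k a : ℕ)
    (s : Finset (Equiv.Perm (Fin n))) :
    ∑ σ ∈ s, x σ • cutSum 𝕜 n (permWord σ) (k + 1) a = 0 ↔
      ∀ b, a < b → b ≤ n → ∀ σ₀ : Equiv.Perm (Fin n),
        ∑ σ ∈ s with ∀ p q, a ≤ p → p < b → a ≤ q → q < b →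
            (permWord σ p < permWord σ q ↔ permWord σ₀ p < permWord σ₀ q),
          x σ • cutSum 𝕜 n (permWord σ) k b = 0 := by
  have e : ∑ σ ∈ s, x σ • cutSum 𝕜 n (permWord σ) (k + 1) a =
      tensorHead 𝕜 (MRSpace 𝕜) k (∑ j ∈ s ×ˢ Finset.Ioc a n,
        basisElt 𝕜 (segIndex (permWord j.1) a j.2) ⊗ₜ[𝕜]
          (x j.1 • cutSum 𝕜 n (permWord j.1) k j.2)) := by
    rw [Finset.sum_product, map_sum]
    refine Finset.sum_congr rfl fun σ _ => ?_
    simp only [cutSum, Finset.smul_sum, map_sum, TensorProduct.tmul_smul, map_smul]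
  have hfib : ∀ b, a < b → b ≤ n → ∀ σ₀ : Equiv.Perm (Fin n),
      (∑ j ∈ s ×ˢ Finset.Ioc a n with
          segIndex (permWord j.1) a j.2 = segIndex (permWord σ₀) a b,
        x j.1 • cutSum 𝕜 n (permWord j.1) k j.2) =
      ∑ σ ∈ s with ∀ p q, a ≤ p → p < b → a ≤ q → q < b →
          (permWord σ p < permWord σ q ↔ permWord σ₀ p < permWord σ₀ q),
        x σ • cutSum 𝕜 n (permWord σ) k b := by
    intro b hab hbn σ₀
    have hiff : ∀ (σ : Equiv.Perm (Fin n)) (c : ℕ), c ∈ Finset.Ioc a n →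
        (segIndex (permWord σ) a c = segIndex (permWord σ₀) a b ↔ c = b ∧ ∀ p q, a ≤ p → p < b →
          a ≤ q → q < b → (permWord σ p < permWord σ q ↔ permWord σ₀ p < permWord σ₀ q)) := by
      intro σ c hc
      obtain ⟨hc₀, hc₁⟩ := Finset.mem_Ioc.mp hc
      rw [segIndex_eq_segIndex_iff hc₀ hab (permWord_injOn σ a c hc₁) (permWord_injOn σ₀ a b hbn)]
      exact and_congr_right fun h => by rw [h]
    rw [Finset.sum_filter, Finset.sum_product, Finset.sum_filter]
    refine Finset.sum_congr rfl fun σ _ => ?_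
    rw [Finset.sum_eq_single_of_mem b (Finset.mem_Ioc.mpr ⟨hab, hbn⟩)]
    · simp only [hiff σ b (Finset.mem_Ioc.mpr ⟨hab, hbn⟩), true_and]
    · intro c hc hcb
      rw [if_neg fun h => hcb ((hiff σ c hc).mp h).1]
  rw [e, LinearEquiv.map_eq_zero_iff, sum_basisElt_tmul_eq_zero_iff 𝕜
    (s ×ˢ Finset.Ioc a n) (fun j => segIndex (permWord j.1) a j.2)
    (fun j => x j.1 • cutSum 𝕜 n (permWord j.1) k j.2)]
  constructor
  · intro h b hab hbn σ₀
    rw [← hfib b hab hbn σ₀]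
    exact h _
  · intro h t
    by_cases ht : ∃ j ∈ s ×ˢ Finset.Ioc a n, segIndex (permWord j.1) a j.2 = t
    · obtain ⟨⟨σ₀, b⟩, hj, rfl⟩ := ht
      obtain ⟨hab, hbn⟩ := Finset.mem_Ioc.mp (Finset.mem_product.mp hj).2
      exact (hfib b hab hbn σ₀).trans (h b hab hbn σ₀)
    · push Not at ht
      rw [Finset.filter_eq_empty_iff.mpr fun j hj => ht j hj, Finset.sum_empty]

open Classical in
/-- A linear combination of permutations is killed by cutting into `k` blocks in all possible ways
if and only if its coefficients sum to `0` over each class of permutations with the same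
standardized blocks. The set `C` contains the right ends of the blocks, hence also `n` unless there
is no block at all. -/
theorem sum_smul_cutSum_eq_zero_iff {n : ℕ} (x : Equiv.Perm (Fin n) → 𝕜) (k : ℕ) :
    ∀ (a : ℕ) (s : Finset (Equiv.Perm (Fin n))),
    ∑ σ ∈ s, x σ • cutSum 𝕜 n (permWord σ) k a = 0 ↔
      ∀ C ⊆ Finset.Ioc a n, n ∈ insert a C → C.card = k → ∀ σ₀ : Equiv.Perm (Fin n),
        ∑ σ ∈ s with SameBlockOrder n a C (permWord σ) (permWord σ₀), x σ = 0 := by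
  induction k with
  | zero =>
    intro a s
    by_cases han : a = n
    · subst han
      have hr : ∀ σ σ₀ : Equiv.Perm (Fin a),
          SameBlockOrder a a ∅ (permWord σ) (permWord σ₀) := by
        intro σ σ₀ p q h₁ h₂
        omega
      simp only [cutSum, if_true, ← Finset.sum_smul, smul_tprod_elim0_eq_zero_iff,
        Finset.card_eq_zero]
      constructor
      · rintro h C - - rfl σ₀
        rwa [Finset.filter_true_of_mem fun σ _ => hr σ σ₀]
      · intro h
        have := h ∅ (Finset.empty_subset _) (Finset.mem_insert_self _ _) rfl 1
        rwa [Finset.filter_true_of_mem fun σ _ => hr σ 1] at this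
    · simp only [cutSum, if_neg han, smul_zero, Finset.sum_const_zero, true_iff]
      intro C _ hn hC
      rw [Finset.card_eq_zero.mp hC] at hn
      simp [Ne.symm han] at hn
  | succ k ih =>
    intro a s
    rw [sum_smul_cutSum_succ_eq_zero_iff]
    simp only [ih, Finset.filter_filter]
    constructor
    · intro h C hC hn hk σ₀
      -- The first block ends at the smallest cut.
      have hne : C.Nonempty := Finset.card_pos.mp (by omega)
      obtain ⟨hab, hbn⟩ := Finset.mem_Ioc.mp (hC (C.min'_mem hne))
      set b := C.min' hne with hb
      have hlt : ∀ d ∈ C.erase b, b < d := fun d hd => C.min'_lt_of_mem_erase_min' hne hd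
      have hbC : b ∈ C := C.min'_mem hne
      have hiff := fun σ : Equiv.Perm (Fin n) =>
        SameBlockOrder.insert_iff (w := permWord σ) (w' := permWord σ₀) hab.le hbn hlt
      rw [Finset.insert_erase hbC] at hiff
      simp only [hiff]
      refine h b hab hbn σ₀ (C.erase b) (fun d hd => Finset.mem_Ioc.mpr ⟨hlt d hd,
        (Finset.mem_Ioc.mp (hC (Finset.mem_of_mem_erase hd))).2⟩) ?_ ?_ σ₀
      · rw [Finset.insert_erase hbC]
        rcases Finset.mem_insert.mp hn with h | h
        · omega
        · exact h
      · rw [Finset.card_erase_of_mem hbC, hk, Nat.add_sub_cancel]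
    · intro h b hab hbn σ₀ C hC hn hk σ₁
      have hlt : ∀ d ∈ C, b < d := fun d hd => (Finset.mem_Ioc.mp (hC hd)).1
      -- A class that is not empty is determined by any of its elements.
      by_cases hσ : ∃ σ₂ : Equiv.Perm (Fin n), (∀ p q, a ≤ p → p < b → a ≤ q → q < b →
          (permWord σ₂ p < permWord σ₂ q ↔ permWord σ₀ p < permWord σ₀ q)) ∧
          SameBlockOrder n b C (permWord σ₂) (permWord σ₁)
      · obtain ⟨σ₂, h₀, h₁⟩ := hσ
        have := h (insert b C) ?_ (Finset.mem_insert_of_mem hn) ?_ σ₂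
        · simp only [SameBlockOrder.insert_iff hab.le hbn hlt] at this
          rw [← this]
          refine Finset.sum_congr (Finset.filter_congr fun σ _ => and_congr ?_ ?_) fun _ _ => rfl
          · refine forall₂_congr fun p q => forall₄_congr fun i₁ i₂ i₃ i₄ => ?_
            rw [h₀ p q i₁ i₂ i₃ i₄]
          · exact ⟨fun h => h.trans h₁.symm, fun h => h.trans h₁⟩
        · refine Finset.insert_subset (Finset.mem_Ioc.mpr ⟨hab, hbn⟩)
            (hC.trans (Finset.Ioc_subset_Ioc_left hab.le))
        · rw [Finset.card_insert_of_notMem fun h => (hlt b h).false, hk]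
      · push Not at hσ
        rw [Finset.filter_false_of_mem fun σ _ h => hσ σ h.1 h.2, Finset.sum_empty]

end MRSpace

open Classical in
/-- The element `x = ∑ x_σ F_σ` is killed by cutting words at the places in `C`: the sum of the
`x_σ` vanishes over each class of permutations `σ` with the same standardized blocks. -/
def BlockNull {𝕜 : Type u} [CommRing 𝕜] {n : ℕ} (C : Finset ℕ) (x : PermSpace 𝕜 n) : Prop :=
  ∀ σ₀ : Equiv.Perm (Fin n),
    ∑ σ with SameBlockOrder n 0 C (permWord σ) (permWord σ₀), x σ = 0

namespace BlockNull

variable {𝕜 : Type u} [CommRing 𝕜] {n : ℕ} {C D : Finset ℕ} {x : PermSpace 𝕜 n}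

/-- Every linear map that depends only on the standardized blocks vanishes at `x`. -/
theorem linearCombination_eq_zero {M : Type*} [AddCommGroup M] [Module 𝕜 M]
    (hx : BlockNull C x) (φ : Equiv.Perm (Fin n) → M)
    (hφ : ∀ σ τ, SameBlockOrder n 0 C (permWord σ) (permWord τ) → φ σ = φ τ) :
    Finsupp.linearCombination 𝕜 φ x = 0 := by
  classical
  let r : Setoid (Equiv.Perm (Fin n)) :=
    ⟨fun σ τ => SameBlockOrder n 0 C (permWord σ) (permWord τ),
      fun _ => .refl _ _ _ _, .symm, .trans⟩
  have hr : ∀ q : Quotient r, Finset.univ.filter (fun σ => (⟦σ⟧ : Quotient r) = q) =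
      Finset.univ.filter fun σ => SameBlockOrder n 0 C (permWord σ) (permWord q.out) := by
    intro q
    refine Finset.filter_congr fun σ _ => ?_
    rw [Quotient.mk_eq_iff_out]
    rfl
  rw [Finsupp.linearCombination_apply, Finsupp.sum_fintype x _ (by simp),
    ← Finset.sum_fiberwise (g := fun σ => (⟦σ⟧ : Quotient r))]
  refine Finset.sum_eq_zero fun q _ => ?_
  rw [hr, Finset.sum_congr rfl fun σ hσ => by rw [hφ σ _ (Finset.mem_filter.mp hσ).2],
    ← Finset.sum_smul, hx, zero_smul]

theorem iff_linearCombination_eq_zero :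
    BlockNull C x ↔ ∀ φ : Equiv.Perm (Fin n) → 𝕜,
      (∀ σ τ, SameBlockOrder n 0 C (permWord σ) (permWord τ) → φ σ = φ τ) →
        Finsupp.linearCombination 𝕜 φ x = 0 := by
  classical
  refine ⟨fun hx => hx.linearCombination_eq_zero, fun h σ₀ => ?_⟩
  have := h (fun σ => if SameBlockOrder n 0 C (permWord σ) (permWord σ₀) then 1 else 0)
    fun σ τ h => by
      have : SameBlockOrder n 0 C (permWord σ) (permWord σ₀) ↔
          SameBlockOrder n 0 C (permWord τ) (permWord σ₀) := ⟨h.symm.trans, h.trans⟩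
      simp only [this]
  rw [Finsupp.linearCombination_apply, Finsupp.sum_fintype x _ (by simp)] at this
  rw [Finset.sum_filter]
  simpa using this

theorem mono (hx : BlockNull C x) (hCD : C ⊆ D) : BlockNull D x :=
  iff_linearCombination_eq_zero.mpr fun φ hφ =>
    hx.linearCombination_eq_zero φ fun σ τ h => hφ σ τ (h.mono hCD)

theorem insert_end_iff : BlockNull (insert n C) x ↔ BlockNull C x := by
  simp only [iff_linearCombination_eq_zero, SameBlockOrder.insert_end_iff]

end BlockNull

theorem MRSpace.iterCoproduct_incl (𝕜 : Type u) [CommRing 𝕜] (k : ℕ) (n : ℕ+) (x : PermSpace 𝕜 n) :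
    MRSpace.iterCoproduct 𝕜 k (MRSpace.incl 𝕜 n x) =
      ∑ σ, x σ • MRSpace.cutSum 𝕜 n (permWord σ) (k + 1) 0 := by
  have hσ : ∀ σ : Equiv.Perm (Fin n), MRSpace.incl 𝕜 n (Finsupp.single σ 1) =
      MRSpace.basisElt 𝕜 (segIndex (permWord σ) 0 n) := fun σ =>
    MRSpace.F_eq_basisElt_segIndex 𝕜 n.pos σ (Nat.zero_add _) (permWord_injOn σ 0 n le_rfl)
      fun p q => by simp [permWord_of_lt]
  have hx : x = ∑ σ, x σ • Finsupp.single σ (1 : 𝕜) := by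
    conv_lhs => rw [← Finsupp.univ_sum_single x]
    simp
  conv_lhs => rw [hx]
  simp only [map_sum, map_smul, hσ]
  refine Finset.sum_congr rfl fun σ _ => ?_
  rw [MRSpace.iterCoproduct_basisElt_segIndex 𝕜 n.pos (permWord_injOn σ 0 n le_rfl)]

/-- The elements of `𝒜^{(k)}` are those that are killed by every choice of `k + 1` cuts, and then
by all larger sets of cuts. -/
theorem mem_coradicalPart_iff (𝕜 : Type u) [CommRing 𝕜] (k : ℕ) (n : ℕ+) (x : PermSpace 𝕜 n) :
    x ∈ coradicalPart 𝕜 k n ↔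
      ∀ C ⊆ Finset.Ioo 0 (n : ℕ), k + 1 ≤ C.card → BlockNull C x := by
  have h₀ : x ∈ coradicalPart 𝕜 k n ↔
      ∑ σ, x σ • MRSpace.cutSum 𝕜 n (permWord σ) (k + 1 + 1) 0 = 0 := by
    rw [← MRSpace.iterCoproduct_incl]
    rfl
  rw [h₀, MRSpace.sum_smul_cutSum_eq_zero_iff]
  have hn := n.pos
  constructor
  · intro h C hC hk
    obtain ⟨D, hD, hDk⟩ := Finset.exists_subset_card_eq hk
    have hnD : (n : ℕ) ∉ D := fun h => (Finset.mem_Ioo.mp (hC (hD h))).2.false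
    refine BlockNull.mono (BlockNull.insert_end_iff.mp
      (h (insert (n : ℕ) D) ?_ (Finset.mem_insert_of_mem (Finset.mem_insert_self _ _)) ?_)) hD
    · exact Finset.insert_subset (Finset.mem_Ioc.mpr ⟨hn, le_rfl⟩)
        ((hD.trans hC).trans Finset.Ioo_subset_Ioc_self)
    · rw [Finset.card_insert_of_notMem hnD, hDk]
  · intro h C hC hnC hk
    have hnC' : (n : ℕ) ∈ C := (Finset.mem_insert.mp hnC).resolve_left hn.ne'
    have := h (C.erase n) ?_ ?_
    · rw [← BlockNull.insert_end_iff, Finset.insert_erase hnC'] at this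
      exact this
    · intro d hd
      obtain ⟨hd₁, hd₂⟩ := Finset.mem_erase.mp hd
      have := Finset.mem_Ioc.mp (hC hd₂)
      exact Finset.mem_Ioo.mpr ⟨this.1, by omega⟩
    · rw [Finset.card_erase_of_mem hnC']
      omega

/-! ### Cutting an inserted word -/

/-- The cuts in `E` that lie strictly inside the block of `m` letters inserted at position `i`. -/
def innerCuts (i m : ℕ) (E : Finset ℕ) : Finset ℕ := (Finset.Ioo 0 m).filter fun d => d + i ∈ E

/-- The position, after a block of `m` letters has been inserted in place of the letter at `i`, of
the cut at `c`: cuts up to the left end of the block stay, and cuts from its right end on move. -/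
def shiftCut (i m c : ℕ) : ℕ := if c ≤ i then c else c + m - 1

/-- The cuts in `E` that do not lie strictly inside the block of `m` letters inserted at position
`i` of a word of `n` letters, as cuts of that word. -/
def outerCuts (n i m : ℕ) (E : Finset ℕ) : Finset ℕ :=
  (Finset.Ioo 0 n).filter fun c => shiftCut i m c ∈ E

theorem card_le_card_innerCuts_add_card_outerCuts {n m i : ℕ} (hi : i < n) {E : Finset ℕ}
    (hE : E ⊆ Finset.Ioo 0 (n + m - 1)) :
    E.card ≤ (innerCuts i m E).card + (outerCuts n i m E).card := by
  have h : E ⊆ (innerCuts i m E).image (· + i) ∪ (outerCuts n i m E).image (shiftCut i m) := by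
    intro e he
    have := Finset.mem_Ioo.mp (hE he)
    simp only [innerCuts, outerCuts, Finset.mem_union, Finset.mem_image, Finset.mem_filter,
      Finset.mem_Ioo]
    rcases le_or_gt e i with c | c
    · exact Or.inr ⟨e, ⟨by omega, by rwa [shiftCut, if_pos c]⟩, if_pos c⟩
    rcases lt_or_ge e (i + m) with c' | c'
    · exact Or.inl ⟨e - i, ⟨by omega, by rwa [Nat.sub_add_cancel c.le]⟩, by omega⟩
    · have h' : e + 1 - m + m - 1 = e := by omega
      have h'' : shiftCut i m (e + 1 - m) = e := by rw [shiftCut, if_neg (by omega), h']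
      exact Or.inr ⟨e + 1 - m, ⟨by omega, by rwa [h'']⟩, h''⟩
  exact (Finset.card_le_card h).trans ((Finset.card_union_le _ _).trans
    (Nat.add_le_add Finset.card_image_le Finset.card_image_le))

/-- The position, in a word of `n` letters, of the letter that the letter at position `p` comes
from after the insertion of a block of `m` letters in place of the letter at `i`; the letters of
the block come from `i`. -/
def insertSource (i m p : ℕ) : ℕ := if p < i then p else if p < i + m then i else p + 1 - m

theorem insertSource_lt {n m i p : ℕ} (hi : i < n) (hp : p < n + m - 1) :
    insertSource i m p < n := by
  unfold insertSource
  split_ifs <;> omega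

theorem insertSource_ne {m i p : ℕ} (hp : ¬ (i ≤ p ∧ p < i + m)) : insertSource i m p ≠ i := by
  unfold insertSource
  split_ifs <;> omega

theorem insertSource_of_mem {m i p : ℕ} (hp : i ≤ p ∧ p < i + m) : insertSource i m p = i := by
  rw [insertSource, if_neg (by omega), if_pos hp.2]

theorem insertWord_of_mem {m i p : ℕ} (s t : ℕ → ℕ) (hp : i ≤ p ∧ p < i + m) :
    insertWord i m s t p = t (p - i) + s i := by
  rw [insertWord, if_neg (by omega), if_pos hp.2]

theorem insertWord_of_notMem {m i p : ℕ} (s t : ℕ → ℕ) (hp : ¬ (i ≤ p ∧ p < i + m)) :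
    insertWord i m s t p = shiftLetter m (s i) (s (insertSource i m p)) := by
  unfold insertWord insertSource
  split_ifs <;> first | rfl | omega

theorem shiftLetter_lt_shiftLetter_iff {m c x y : ℕ} (hx : x ≠ c) (hy : y ≠ c) :
    shiftLetter m c x < shiftLetter m c y ↔ x < y := by
  unfold shiftLetter
  split_ifs <;> omega

theorem shiftLetter_lt_add_iff {m c x b : ℕ} (hb : b < m) :
    shiftLetter m c x < b + c ↔ x < c := by
  unfold shiftLetter
  split_ifs <;> omega

theorem add_lt_shiftLetter_iff {m c x b : ℕ} (hx : x ≠ c) (hb : b < m) :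
    b + c < shiftLetter m c x ↔ c < x := by
  unfold shiftLetter
  split_ifs <;> omega

/-- The relative order of two letters of an inserted word, in terms of the two original words. -/
theorem insertWord_lt_insertWord_iff {n m i : ℕ} (hi : i < n) {s t : ℕ → ℕ}
    (hs : ∀ a b, a < n → b < n → s a = s b → a = b) (ht : ∀ p < m, t p < m) {p q : ℕ}
    (hp : p < n + m - 1) (hq : q < n + m - 1) :
    insertWord i m s t p < insertWord i m s t q ↔
      if (i ≤ p ∧ p < i + m) ∧ (i ≤ q ∧ q < i + m) then t (p - i) < t (q - i)
      else s (insertSource i m p) < s (insertSource i m q) := by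
  have hne : ∀ p < n + m - 1, ¬ (i ≤ p ∧ p < i + m) → s (insertSource i m p) ≠ s i :=
    fun p hp h e => insertSource_ne h (hs _ _ (insertSource_lt hi hp) hi e)
  by_cases cp : i ≤ p ∧ p < i + m <;> by_cases cq : i ≤ q ∧ q < i + m
  · rw [if_pos ⟨cp, cq⟩, insertWord_of_mem s t cp, insertWord_of_mem s t cq]
    omega
  · rw [if_neg fun h => cq h.2, insertWord_of_mem s t cp, insertWord_of_notMem s t cq,
      insertSource_of_mem cp]
    exact add_lt_shiftLetter_iff (hne q hq cq) (ht _ (by omega))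
  · rw [if_neg fun h => cp h.1, insertWord_of_notMem s t cp, insertWord_of_mem s t cq,
      insertSource_of_mem cq]
    exact shiftLetter_lt_add_iff (ht _ (by omega))
  · rw [if_neg fun h => cp h.1, insertWord_of_notMem s t cp, insertWord_of_notMem s t cq]
    exact shiftLetter_lt_shiftLetter_iff (hne p hp cp) (hne q hq cq)

/-- The standardized blocks of an inserted word depend on the inserted word only through its own
standardized blocks. -/
theorem SameBlockOrder.insertWord_right {n m i : ℕ} (hi : i < n) {s t t' : ℕ → ℕ} {E : Finset ℕ}
    (hs : ∀ a b, a < n → b < n → s a = s b → a = b) (ht : ∀ p < m, t p < m)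
    (ht' : ∀ p < m, t' p < m) (h : SameBlockOrder m 0 (innerCuts i m E) t t') :
    SameBlockOrder (n + m - 1) 0 E (insertWord i m s t) (insertWord i m s t') := by
  intro p q _ hp _ hq hE
  rw [insertWord_lt_insertWord_iff hi hs ht hp hq, insertWord_lt_insertWord_iff hi hs ht' hp hq]
  split_ifs with c
  · refine h (p - i) (q - i) (Nat.zero_le _) (by omega) (Nat.zero_le _) (by omega) fun d hd => ?_
    have := hE _ (Finset.mem_filter.mp hd).2
    omega
  · exact Iff.rfl

/-- The standardized blocks of an inserted word depend on the word receiving the insertion only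
through its own standardized blocks. -/
theorem SameBlockOrder.insertWord_left {n m i : ℕ} (hi : i < n) {s s' t : ℕ → ℕ} {E : Finset ℕ}
    (hs : ∀ a b, a < n → b < n → s a = s b → a = b)
    (hs' : ∀ a b, a < n → b < n → s' a = s' b → a = b) (ht : ∀ p < m, t p < m)
    (h : SameBlockOrder n 0 (outerCuts n i m E) s s') :
    SameBlockOrder (n + m - 1) 0 E (insertWord i m s t) (insertWord i m s' t) := by
  intro p q _ hp _ hq hE
  rw [insertWord_lt_insertWord_iff hi hs ht hp hq, insertWord_lt_insertWord_iff hi hs' ht hp hq]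
  split_ifs with c
  · exact Iff.rfl
  · refine h _ _ (Nat.zero_le _) (insertSource_lt hi hp) (Nat.zero_le _) (insertSource_lt hi hq)
      fun c hc => ?_
    have := hE _ (Finset.mem_filter.mp hc).2
    have := Finset.mem_Ioo.mp (Finset.mem_filter.mp hc).1
    unfold insertSource
    unfold shiftCut at *
    split_ifs at * <;> omega

/-! ### The operad filtration -/

section Filtration

variable {𝕜 : Type u} [CommRing 𝕜]

theorem linearCombination_permComp {M : Type*} [AddCommGroup M] [Module 𝕜 M] {n m : ℕ} (i : Fin n)
    (ψ : Equiv.Perm (Fin (n + m - 1)) → M) (x : PermSpace 𝕜 n) (y : PermSpace 𝕜 m) :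
    Finsupp.linearCombination 𝕜 ψ (permComp 𝕜 i x y) =
      Finsupp.linearCombination 𝕜
        (fun σ => Finsupp.linearCombination 𝕜 (fun τ => ψ (permInsert i σ τ)) y) x := by
  induction x using PermSpace.induction with
  | zero => simp
  | add x x' hx hx' => simp only [map_add, LinearMap.add_apply, hx, hx']
  | smul c x hx => simp only [map_smul, LinearMap.smul_apply, hx]
  | basis σ =>
  rw [Finsupp.linearCombination_single, one_smul]
  induction y using PermSpace.induction with
  | zero => simp
  | add y y' hy hy' => simp only [map_add, hy, hy']
  | smul c y hy => simp only [map_smul, hy]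
  | basis τ => simp [permComp_single]

theorem linearCombination_permComp' {M : Type*} [AddCommGroup M] [Module 𝕜 M] {n m : ℕ} (i : Fin n)
    (ψ : Equiv.Perm (Fin (n + m - 1)) → M) (x : PermSpace 𝕜 n) (y : PermSpace 𝕜 m) :
    Finsupp.linearCombination 𝕜 ψ (permComp 𝕜 i x y) =
      Finsupp.linearCombination 𝕜
        (fun τ => Finsupp.linearCombination 𝕜 (fun σ => ψ (permInsert i σ τ)) x) y := by
  rw [linearCombination_permComp]
  simp only [Finsupp.linearCombination_apply, Finsupp.smul_sum]
  rw [Finsupp.sum_comm]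
  refine Finsupp.sum_congr fun τ _ => Finsupp.sum_congr fun σ _ => smul_comm _ _ _

theorem sameBlockOrder_permInsert_iff {n m : ℕ} (i : Fin n) (σ σ' : Equiv.Perm (Fin n))
    (τ τ' : Equiv.Perm (Fin m)) (E : Finset ℕ) :
    SameBlockOrder (n + m - 1) 0 E (permWord (permInsert i σ τ)) (permWord (permInsert i σ' τ')) ↔
      SameBlockOrder (n + m - 1) 0 E (insertWord i m (permWord σ) (permWord τ))
        (insertWord i m (permWord σ') (permWord τ')) := by
  refine forall₂_congr fun p q => forall₅_congr fun _ hp _ hq _ => ?_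
  simp only [permWord_permInsert _ _ _ _ hp, permWord_permInsert _ _ _ _ hq]

theorem BlockNull.permComp_right {n m : ℕ} (i : Fin n) {E : Finset ℕ} (x : PermSpace 𝕜 n)
    {y : PermSpace 𝕜 m} (hy : BlockNull (innerCuts i m E) y) :
    BlockNull E (permComp 𝕜 i x y) := by
  refine iff_linearCombination_eq_zero.mpr fun ψ hψ => ?_
  rw [linearCombination_permComp]
  have : ∀ σ, Finsupp.linearCombination 𝕜 (fun τ => ψ (permInsert i σ τ)) y = 0 := fun σ =>
    hy.linearCombination_eq_zero _ fun τ τ' h => hψ _ _ <|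
      (sameBlockOrder_permInsert_iff i σ σ τ τ' E).mpr <|
        SameBlockOrder.insertWord_right i.2 (permWord_inj σ) (permWord_lt τ) (permWord_lt τ') h
  simp [this, Finsupp.linearCombination_apply]

theorem BlockNull.permComp_left {n m : ℕ} (i : Fin n) {E : Finset ℕ} {x : PermSpace 𝕜 n}
    (y : PermSpace 𝕜 m) (hx : BlockNull (outerCuts n i m E) x) :
    BlockNull E (permComp 𝕜 i x y) := by
  refine iff_linearCombination_eq_zero.mpr fun ψ hψ => ?_
  rw [linearCombination_permComp']
  have : ∀ τ, Finsupp.linearCombination 𝕜 (fun σ => ψ (permInsert i σ τ)) x = 0 := fun τ =>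
    hx.linearCombination_eq_zero _ fun σ σ' h => hψ _ _ <|
      (sameBlockOrder_permInsert_iff i σ σ' τ τ E).mpr <|
        SameBlockOrder.insertWord_left i.2 (permWord_inj σ) (permWord_inj σ') (permWord_lt τ) h
  simp [this, Finsupp.linearCombination_apply]

/-- Among `k + h + 1` cuts, there are at least `h + 1` inside the inserted block or at least `k + 1`
outside of it. -/
theorem permComp_mem_coradicalPart {k h : ℕ} {n m : ℕ+} (i : Fin n) {x : PermSpace 𝕜 n}
    {y : PermSpace 𝕜 m} (hx : x ∈ coradicalPart 𝕜 k n) (hy : y ∈ coradicalPart 𝕜 h m) :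
    permComp 𝕜 i x y ∈ coradicalPart 𝕜 (k + h) (compArity n m) := by
  rw [mem_coradicalPart_iff] at hx hy
  refine (mem_coradicalPart_iff 𝕜 _ _ _).mpr fun E hE hcard => ?_
  have hE' := card_le_card_innerCuts_add_card_outerCuts (m := m) i.2 hE
  by_cases hin : h + 1 ≤ (innerCuts i m E).card
  · exact (hy _ (Finset.filter_subset _ _) hin).permComp_right i x
  · exact (hx (outerCuts n i m E) (Finset.filter_subset _ _) (by omega)).permComp_left i y

/-- The map `Δ^{(1)}` into the tensor power `H^{⊗ 2}` has the same kernel as `Δ`. -/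
theorem coradicalPart_zero (n : ℕ+) : coradicalPart 𝕜 0 n = primitivePart 𝕜 n := by
  suffices h : MRSpace.coradical 𝕜 1 = MRSpace.primitives 𝕜 by
    rw [coradicalPart, zero_add, h, primitivePart]
  ext x
  have h : MRSpace.coproduct 𝕜 x ⊗ₜ[𝕜]
      PiTensorProduct.tprod 𝕜 (Fin.elim0 : Fin 0 → MRSpace 𝕜) = 0 ↔ MRSpace.coproduct 𝕜 x = 0 := by
    refine ⟨fun h => ?_, fun h => by rw [h, TensorProduct.zero_tmul]⟩
    have := congrArg ((TensorProduct.rid 𝕜 _).toLinearMap ∘ₗ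
      (PiTensorProduct.isEmptyEquiv (R := 𝕜) (s := fun _ => MRSpace 𝕜) (Fin 0)).toLinearMap.lTensor
        _) h
    simpa using this
  have e : ((tensorHead 𝕜 (MRSpace 𝕜) 0).toLinearMap.lTensor (MRSpace 𝕜)) =
    ((tensorHead 𝕜 (MRSpace 𝕜) 0).lTensor (MRSpace 𝕜)).toLinearMap := rfl
  rw [MRSpace.coradical, MRSpace.primitives, LinearMap.mem_ker, LinearMap.mem_ker, ← h]
  simp only [MRSpace.iterCoproduct, LinearMap.comp_apply, e, LinearEquiv.coe_coe,
    LinearEquiv.map_eq_zero_iff, MRSpace.subsingletonEquiv_symm_eq_tensorHead,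
    LinearEquiv.symm_apply_apply, LinearMap.rTensor_tmul]

theorem permComp_mem_primitivePart {n m : ℕ+} (i : Fin n) {x : PermSpace 𝕜 n}
    {y : PermSpace 𝕜 m} (hx : x ∈ primitivePart 𝕜 n) (hy : y ∈ primitivePart 𝕜 m) :
    permComp 𝕜 i x y ∈ primitivePart 𝕜 (compArity n m) := by
  have h : permComp 𝕜 i x y ∈ coradicalPart 𝕜 (0 + 0) (compArity n m) :=
    permComp_mem_coradicalPart i ((coradicalPart_zero n).ge hx) ((coradicalPart_zero m).ge hy)
  rw [add_zero] at h
  exact (coradicalPart_zero (compArity n m)).le h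

end Filtration

theorem theorem2p1 (𝕜 : Type u) [CommRing 𝕜] :
    (nsAssoc 𝕜).IsFiltration (coradicalPart 𝕜) ∧
      (∀ n : ℕ+, coradicalPart 𝕜 0 n = primitivePart 𝕜 n) ∧
      (nsAssoc 𝕜).IsSuboperad (primitivePart 𝕜) := by
  refine ⟨⟨fun k n x hx => ?_, fun k h n m i x y hx hy => permComp_mem_coradicalPart i hx hy⟩,
    coradicalPart_zero, ?_, fun {n m} i x y hx hy => ?_⟩
  · rw [mem_coradicalPart_iff] at hx ⊢
    exact fun C hC hk => hx C hC (by omega)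
  · refine (coradicalPart_zero 1).le ((mem_coradicalPart_iff 𝕜 0 1 _).mpr fun C hC hk => ?_)
    -- There is no place to cut a word of one letter.
    have := Finset.card_le_card hC
    rw [Nat.card_Ioo, PNat.one_coe] at this
    omega
  · exact permComp_mem_primitivePart i hx hy
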